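/- A principle is given by a class of instances $X\subseteq\omega$ together with, for each instance, a class of solutions $Y\subseteq\omega$. A principle $\mathsf{Q}$ is strongly computably reducible to a principle $\mathsf{P}$, written $\mathsf{Q}\leq_{\mathrm{sc}}\mathsf{P}$, if every instance $X$ of $\mathsf{Q}$ computes (in the sense of Turing reducibility) an instance $\widehat X$ of $\mathsf{P}$ such that every solution $\widehat Y$ to $\widehat X$ computes a solution $Y$ to $X$. For $k\geq 1$, a coloring $c:[\omega]^2\to\{0,\ldots,k-1\}$ is stable if for each $x$ there are a color $j<k$ and a number $z$ such that $c(x,y)=j$ for all $y\geq z$ with $y>x$; we then write $\lim_y c(x,y)=j$. A set $H\subseteq\omega$ is homogeneous for $c$ if $c$ is constant on $[H]^2$, and a set $L\subseteq\omega$ is limit-homogeneous for a stable coloring $c$ if there is a $j<k$ such that $\lim_y c(x,y)=j$ for all $x\in L$. The instances of $\mathsf{SRT}^2_k$ and of $\mathsf{D}^2_k$ are the stable colorings $c:[\omega]^2\to\{0,\ldots,k-1\}$ (coded as subsets of $\omega$ by their graphs); the solutions to $c$ are, for $\mathsf{SRT}^2_k$, the infinite homogeneous sets for $c$, and, for $\mathsf{D}^2_k$,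 the infinite limit-homogeneous sets for $c$. The principle $\mathsf{D}^2_{<\infty}$ is $\forall k\,\mathsf{D}^2_k$: its instances are the pairs consisting of a number $k\geq 1$ and an instance $c$ of $\mathsf{D}^2_k$, and its solutions are the infinite limit-homogeneous sets for $c$. \textbf{Corollary.} $\mathsf{SRT}^2_2\nleq_{\mathrm{sc}}\mathsf{D}^2_{<\infty}$. In particular, $\mathsf{SRT}^2_2\nleq_{\mathrm{sc}}\mathsf{D}^2_2$, which gives a negative answer to the question of Hirschfeldt and Jockusch whether $\mathsf{SRT}^2_2\leq_{\mathrm{sc}}\mathsf{D}^2_2$. -/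

import Mathlib

namespace StrongReductions

/-- The characteristic function of a set of natural numbers, as an oracle. -/
noncomputable def charFn (X : Set ℕ) : ℕ →. ℕ :=
  fun n => Part.some (X.indicator (fun _ => 1) n)

/-- The set `Y` computes the set `X`, i.e. `X` is Turing reducible to `Y`. -/
def Computes (Y X : Set ℕ) : Prop :=
  TuringReducible (charFn X) (charFn Y)

/-- A principle of the form "every instance has a solution", where instances and solutions
are sets of natural numbers. -/
structure Principle where
  /-- `X` is an instance. -/
  IsInstance : Set ℕ → Prop
  /-- `Y` is a solution to the instance `X`. -/
  IsSolution : Set ℕ → Set ℕ → Prop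

/-- `Q` is strongly computably reducible to `P`: every instance `X` of `Q` computes an instance
`X'` of `P` such that every solution `Y'` to `X'` computes a solution `Y` to `X`. -/
def StronglyComputablyReducible (Q P : Principle) : Prop :=
  ∀ X, Q.IsInstance X →
    ∃ X', P.IsInstance X' ∧ Computes X X' ∧
      ∀ Y', P.IsSolution X' Y' → ∃ Y, Q.IsSolution X Y ∧ Computes Y' Y

/-- A `k`-coloring of the two-element subsets of `ℕ`. The color of `{x, y}` with `x < y`
is `c x y`; the values `c x y` with `y ≤ x` are never looked at. -/
abbrev Coloring (k : ℕ) : Type := ℕ → ℕ → Fin k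

namespace Coloring

variable {k : ℕ}

/-- `lim_y c(x, y) = j`. -/
def HasLimit (c : Coloring k) (x : ℕ) (j : Fin k) : Prop :=
  ∃ z, ∀ y, z ≤ y → x < y → c x y = j

/-- `c` is stable: `lim_y c(x, y)` exists for every `x`. -/
def Stable (c : Coloring k) : Prop :=
  ∀ x, ∃ j, HasLimit c x j

/-- `H` is homogeneous for `c`. -/
def Homogeneous (c : Coloring k) (H : Set ℕ) : Prop :=
  ∃ j, ∀ x ∈ H, ∀ y ∈ H, x < y → c x y = j

/-- `L` is limit-homogeneous for `c`. -/
def LimitHomogeneous (c : Coloring k) (L : Set ℕ) : Prop :=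
  ∃ j, ∀ x ∈ L, HasLimit c x j

/-- The coloring as a set of natural numbers: the graph of `c` on the pairs `x < y`. -/
def graph (c : Coloring k) : Set ℕ :=
  {n | ∃ x y, x < y ∧ n = Nat.pair (Nat.pair x y) (c x y)}

end Coloring

/-- `SRT²ₖ`: every stable coloring `c : [ω]² → k` has an infinite homogeneous set. -/
def SRT2 (k : ℕ) : Principle where
  IsInstance X := ∃ c : Coloring k, c.Stable ∧ X = c.graph
  IsSolution X Y := ∃ c : Coloring k, c.Stable ∧ X = c.graph ∧ Y.Infinite ∧ c.Homogeneous Y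

/-- `D²ₖ`: every stable coloring `c : [ω]² → k` has an infinite limit-homogeneous set. -/
def D2 (k : ℕ) : Principle where
  IsInstance X := ∃ c : Coloring k, c.Stable ∧ X = c.graph
  IsSolution X Y := ∃ c : Coloring k, c.Stable ∧ X = c.graph ∧ Y.Infinite ∧ c.LimitHomogeneous Y

/-- The join `X ⊕ Y`. -/
def join (X Y : Set ℕ) : Set ℕ :=
  {n | (∃ m ∈ X, n = 2 * m) ∨ ∃ m ∈ Y, n = 2 * m + 1}

/-- `∀ k ≥ 1, P k` as a single principle: an instance consists of a number `k ≥ 1` together with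
an instance `X` of `P k`, coded as `{k} ⊕ X`, and its solutions are those of the instance `X`
of `P k`. -/
def Principle.forallNum (P : ℕ → Principle) : Principle where
  IsInstance Z := ∃ k X, 1 ≤ k ∧ (P k).IsInstance X ∧ Z = join {k} X
  IsSolution Z Y := ∃ k X, 1 ≤ k ∧ (P k).IsInstance X ∧ Z = join {k} X ∧ (P k).IsSolution X Y

/-- `D²_{<∞}`, i.e. the principle `∀ k, D²ₖ`. -/
def D2LtInfty : Principle := Principle.forallNum D2

end StrongReductions

/-! Cut the natural numbers into blocks and give a pair color 1 if it lies in one block, color 0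
otherwise. All limits are 0, so an infinite homogeneous set meets each block at most once. If the
blocks grow fast enough, every finite partition, however complicated, has a part with an infinite
subset computing no such set (`exists_subset_not_spread`). The limit-color classes of a `D2`
instance form such a partition.

The subsets are built by Mathias forcing, one in each part simultaneously. Given one functional per
part, there are two cases. Either every partition of the reservoir allows a finite extension making
some functional accept two numbers from n on, with a bound that compactness makes independent of the
partition; or some partition allows none, and thinning the reservoir to one of its parts makes a
functional accept only finitely many numbers. Neither bounds nor reservoirs refer to the partition
to be defeated, so there are only countably many requirements and the blocks can be fixed in advance
(`exists_cut`). -/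

open Filter

namespace StrongReductions

/-! ### Oracle computations and their use -/

/-- Codes for functionals that are partial recursive relative to an oracle. -/
inductive OracleCode : Type
  | zero | succ | left | right | oracle
  | pair (a b : OracleCode)
  | comp (a b : OracleCode)
  | prec (a b : OracleCode)
  | rfind (a : OracleCode)
  deriving Countable

namespace OracleCode

/-- The partial function with a given code, relative to the oracle `Y`. -/
noncomputable def eval (Y : Set ℕ) : OracleCode → ℕ →. ℕ
  | zero => fun _ => 0
  | succ => Nat.succ
  | left => fun n => (Nat.unpair n).1
  | right => fun n => (Nat.unpair n).2
  | oracle => charFn Y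
  | pair a b => fun n => Nat.pair <$> eval Y a n <*> eval Y b n
  | comp a b => fun n => eval Y b n >>= eval Y a
  | prec a b => fun p =>
      let (x, n) := Nat.unpair p
      n.rec (eval Y a x) fun y IH => do
        let i ← IH
        eval Y b (Nat.pair x (Nat.pair y i))
  | rfind a => fun x => Nat.rfind fun n => (fun m => m = 0) <$> eval Y a (Nat.pair x n)

/-- Codes make the functionals countable, as both the cut points and the generic sequence require.
-/
theorem exists_eval_eq {Y : Set ℕ} {f : ℕ →. ℕ} (hf : Nat.RecursiveIn {charFn Y} f) :
    ∃ a : OracleCode, a.eval Y = f := by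
  induction hf with
  | zero => exact ⟨zero, rfl⟩
  | succ => exact ⟨succ, rfl⟩
  | left => exact ⟨left, rfl⟩
  | right => exact ⟨right, rfl⟩
  | oracle g hg => exact ⟨oracle, hg.symm⟩
  | pair _ _ ih₁ ih₂ =>
    obtain ⟨a, rfl⟩ := ih₁
    obtain ⟨b, rfl⟩ := ih₂
    exact ⟨pair a b, rfl⟩
  | comp _ _ ih₁ ih₂ =>
    obtain ⟨a, rfl⟩ := ih₁
    obtain ⟨b, rfl⟩ := ih₂
    exact ⟨comp a b, rfl⟩
  | prec _ _ ih₁ ih₂ =>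
    obtain ⟨a, rfl⟩ := ih₁
    obtain ⟨b, rfl⟩ := ih₂
    exact ⟨prec a b, rfl⟩
  | rfind _ ih =>
    obtain ⟨a, rfl⟩ := ih
    exact ⟨rfind a, rfl⟩

/-- The use principle: a convergent computation depends on a finite part of the oracle. -/
theorem eventually_mem_eval {Y : Set ℕ} (a : OracleCode) {n m : ℕ} (h : m ∈ a.eval Y n) :
    ∀ᶠ u in atTop, ∀ Z : Set ℕ, (∀ z < u, z ∈ Z ↔ z ∈ Y) → m ∈ a.eval Z n := by
  induction a generalizing n m with
  | zero | succ | left | right => exact .of_forall fun _ _ _ => h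
  | oracle =>
    filter_upwards [eventually_gt_atTop n] with u hu Z hZ
    have : charFn Z n = charFn Y n := by
      classical
      simp only [charFn, Set.indicator_apply, hZ n hu]
    simpa only [eval, this] using h
  | pair a b iha ihb =>
    simp only [eval, seq_eq_bind_map, Part.map_eq_map, Part.bind_eq_bind, Part.mem_bind_iff,
      Part.mem_map_iff] at h ⊢
    obtain ⟨_, ⟨x, hx, rfl⟩, y, hy, rfl⟩ := h
    filter_upwards [iha hx, ihb hy] with u h₁ h₂ Z hZ
    exact ⟨_, ⟨x, h₁ Z hZ, rfl⟩, y, h₂ Z hZ, rfl⟩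
  | comp a b iha ihb =>
    obtain ⟨x, hx, hm⟩ := Part.mem_bind_iff.1 h
    filter_upwards [ihb hx, iha hm] with u h₁ h₂ Z hZ
    exact Part.mem_bind_iff.2 ⟨x, h₁ Z hZ, h₂ Z hZ⟩
  | prec a b iha ihb =>
    simp only [eval] at h ⊢
    generalize (Nat.unpair n).2 = k at h ⊢
    induction k generalizing m with
    | zero => exact iha h
    | succ k ih =>
      obtain ⟨x, hx, hm⟩ := Part.mem_bind_iff.1 h
      filter_upwards [ih hx, ihb hm] with u h₁ h₂ Z hZ
      exact Part.mem_bind_iff.2 ⟨x, h₁ Z hZ, h₂ Z hZ⟩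
  | rfind a iha =>
    obtain ⟨htrue, hfalse⟩ := Nat.mem_rfind.1 h
    obtain ⟨x, hx, hx'⟩ := (Part.mem_map_iff _).1 htrue
    have hlt : ∀ k, ∃ v, k < m → v ∈ a.eval Y (Nat.pair n k) ∧ decide (v = 0) = false := by
      intro k
      by_cases hk : k < m
      · obtain ⟨v, hv⟩ := (Part.mem_map_iff _).1 (hfalse hk)
        exact ⟨v, fun _ => hv⟩
      · exact ⟨0, fun h => absurd h hk⟩
    choose v hv using hlt
    have hall : ∀ᶠ u in atTop, ∀ k ∈ Set.Iio m, ∀ Z : Set ℕ, (∀ z < u, z ∈ Z ↔ z ∈ Y) →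
        v k ∈ a.eval Z (Nat.pair n k) :=
      (eventually_all_finite (Set.finite_Iio m)).2 fun k hk => iha (hv k hk).1
    filter_upwards [iha hx, hall] with u h₁ h₂ Z hZ
    exact Nat.mem_rfind.2 ⟨(Part.mem_map_iff _).2 ⟨x, h₁ Z hZ, hx'⟩,
      fun {k} hk => (Part.mem_map_iff _).2 ⟨v k, h₂ k hk Z hZ, (hv k hk).2⟩⟩

/-- The set of numbers that a functional accepts relative to the oracle `Y`. -/
def accepts (a : OracleCode) (Y : Set ℕ) : Set ℕ :=
  {x | 1 ∈ a.eval Y x}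

theorem eventually_mem_accepts {Y : Set ℕ} (a : OracleCode) {x : ℕ} (h : x ∈ a.accepts Y) :
    ∀ᶠ u in atTop, ∀ Z : Set ℕ, (∀ z < u, z ∈ Z ↔ z ∈ Y) → x ∈ a.accepts Z :=
  a.eventually_mem_eval h

end OracleCode

theorem Computes.exists_accepts_eq {Y X : Set ℕ} (h : Computes Y X) :
    ∃ a : OracleCode, a.accepts Y = X := by
  obtain ⟨a, ha⟩ := OracleCode.exists_eval_eq (RecursiveIn.iff_nat.1 h)
  refine ⟨a, Set.ext fun x => ?_⟩
  classical
  simp only [OracleCode.accepts, Set.mem_ofPred_eq, ha, charFn, Part.mem_some_iff,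
    Set.indicator_apply]
  split_ifs with hx <;> simp [hx]

/-! ### Tasks and compactness -/

/-- Finitely many finite stems, each with a functional to be diagonalized against. -/
abbrev Task (m : ℕ) : Type := Fin m → Finset ℕ × OracleCode

/-- Some part of the partition `p` of `X` has a finite subset that, added to the corresponding
stem, makes the functional accept two elements of `[n, N)`. -/
def Task.Hits {m : ℕ} (r : Task m) (X : Set ℕ) (n N : ℕ) (p : ℕ → Fin m) : Prop :=
  ∃ (i : Fin m) (E : Finset ℕ), (∀ z ∈ E, z ∈ X ∧ p z = i) ∧
    ∃ x ∈ (r i).2.accepts ((r i).1 ∪ E), ∃ y ∈ (r i).2.accepts ((r i).1 ∪ E),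
      n ≤ x ∧ x < y ∧ y < N

theorem Task.Hits.mono {m : ℕ} {r : Task m} {X : Set ℕ} {n N N' : ℕ} {p : ℕ → Fin m}
    (h : r.Hits X n N p) (hN : N ≤ N') : r.Hits X n N' p := by
  obtain ⟨i, E, hE, x, hx, y, hy, hnx, hxy, hyN⟩ := h
  exact ⟨i, E, hE, x, hx, y, hy, hnx, hxy, hyN.trans_le hN⟩

/-- Compactness of the space of partitions. -/
theorem Task.exists_forall_not_hits {m : ℕ} (r : Task m) (X : Set ℕ) (n : ℕ)
    (h : ∀ N, ∃ p, ¬ r.Hits X n N p) : ∃ p, ∀ N, ¬ r.Hits X n N p := by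
  choose q hq using h
  -- The partition `p` is an ultrafilter limit of the `q N`. A hit for `p` involves only the finite
  -- set `E`, so it is also a hit for some `q M` with `y < M`.
  have hlim : ∀ x, ∃ j, ∀ᶠ N in (hyperfilter ℕ : Filter ℕ), q N x = j := fun x =>
    Ultrafilter.eventually_exists_iff.1 (.of_forall fun N => ⟨_, rfl⟩)
  choose p hp using hlim
  refine ⟨p, ?_⟩
  rintro N ⟨i, E, hE, x, hx, y, hy, hnx, hxy, hyN⟩
  have hagree : ∀ᶠ N in (hyperfilter ℕ : Filter ℕ), ∀ z ∈ E, q N z = p z :=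
    (eventually_all_finset E).2 fun z _ => hp z
  have hlarge : ∀ᶠ N in (hyperfilter ℕ : Filter ℕ), y < N :=
    (eventually_gt_atTop y).filter_mono Nat.hyperfilter_le_atTop
  obtain ⟨M, hM, hyM⟩ := (hagree.and hlarge).exists
  exact hq M ⟨i, E, fun z hz => ⟨(hE z hz).1, (hM z hz).trans (hE z hz).2⟩,
    x, hx, y, hy, hnx, hxy, hyM⟩

/-! ### Countably many reservoirs -/

/-- A step in the construction of a reservoir: remove an initial segment, or pass to a part of
a partition that prevents a task from being hit. -/
abbrev Step : Type := ℕ ⊕ Σ m : ℕ, Task m × Fin m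

/-- The reservoirs are a countable family of sets, closed under `Step`s. -/
noncomputable def reservoir : List Step → Set ℕ
  | [] => Set.univ
  | .inl u :: l => reservoir l ∩ Set.Ici u
  -- The partition `h.choose` depends only on the reservoir and the task, which keeps the family
  -- countable. If there is none, nothing is removed.
  | .inr ⟨_, r, i⟩ :: l =>
      {x ∈ reservoir l |
        ∀ h : ∃ p, ∃ n, ∀ N, ¬ r.Hits (reservoir l) n N p, h.choose x = i}

theorem reservoir_inl_infinite {l : List Step} (h : (reservoir l).Infinite) (u : ℕ) :
    (reservoir (.inl u :: l)).Infinite := by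
  have : reservoir (.inl u :: l) = reservoir l \ Set.Iio u := by
    ext x; simp [reservoir]
  exact this ▸ h.sdiff (Set.finite_Iio u)

/-- By pigeonhole some part of the unhit partition is infinite. Two accepted numbers from `n` on,
using elements of that part, would be a hit. -/
theorem exists_reservoir_not_hits {m : ℕ} (r : Task m) {l : List Step}
    (hl : (reservoir l).Infinite) (h : ∃ p, ∃ n, ∀ N, ¬ r.Hits (reservoir l) n N p) :
    ∃ l' i, (reservoir l').Infinite ∧ reservoir l' ⊆ reservoir l ∧ ∃ n,
      ∀ E : Finset ℕ, ↑E ⊆ reservoir l' → ∀ x ∈ (r i).2.accepts ((r i).1 ∪ E),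
        ∀ y ∈ (r i).2.accepts ((r i).1 ∪ E), n ≤ x → y ≤ x := by
  have hex : ∃ i, (reservoir l ∩ h.choose ⁻¹' {i}).Infinite := by
    by_contra! hfin
    refine hl ((Set.finite_iUnion hfin).subset fun x hx => ?_)
    exact Set.mem_iUnion.2 ⟨h.choose x, hx, rfl⟩
  obtain ⟨i, hi⟩ := hex
  obtain ⟨n, hn⟩ := h.choose_spec
  refine ⟨.inr ⟨m, r, i⟩ :: l, i, hi.mono fun x hx => ⟨hx.1, fun _ => hx.2⟩,
    fun x hx => hx.1, n, fun E hE x hx y hy hnx => ?_⟩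
  by_contra! hxy
  exact hn (y + 1) ⟨i, E, fun z hz => ⟨(hE hz).1, (hE hz).2 h⟩,
    x, hx, y, hy, hnx, hxy, y.lt_succ_self⟩

/-! ### Cut points and diagonalization -/

/-- A sequence of cut points that grows too fast for all hitting bounds. -/
theorem exists_cut : ∃ cut : ℕ → ℕ, StrictMono cut ∧
    ∀ (l : List Step) (m : ℕ) (r : Task m),
      (∀ n, ∃ N, ∀ p, r.Hits (reservoir l) n N p) →
        ∃ s, ∀ p, r.Hits (reservoir l) (cut s) (cut (s + 1)) p := by
  classical
  have : Nonempty (List Step × Σ m, Task m) := ⟨[], 0, Fin.elim0⟩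
  obtain ⟨g, hg⟩ := exists_surjective_nat (List Step × Σ m, Task m)
  have hb : ∀ s n, ∃ N, (∃ N, ∀ p, (g s).2.2.Hits (reservoir (g s).1) n N p) →
      ∀ p, (g s).2.2.Hits (reservoir (g s).1) n N p := fun s n => by
    by_cases h : ∃ N, ∀ p, (g s).2.2.Hits (reservoir (g s).1) n N p
    · exact ⟨h.choose, fun _ => h.choose_spec⟩
    · exact ⟨0, fun h' => absurd h' h⟩
  choose bound hbound using hb
  -- Entry `s` of the enumeration is served at stage `s`, with its bound taken from `cut s` on; `n +
  -- 1` ensures strict growth.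
  let cut : ℕ → ℕ := fun s => s.rec 0 fun s n => max (n + 1) (bound s n)
  refine ⟨cut, strictMono_nat_of_lt_succ fun s => ?_, fun l m r h => ?_⟩
  · exact (Nat.lt_succ_self _).trans_le (le_max_left _ _)
  · obtain ⟨s, hs⟩ := hg (l, ⟨m, r⟩)
    have := hbound s (cut s)
    rw [hs] at this
    exact ⟨s, fun p => (this (h _) p).mono (le_max_right _ _)⟩

/-- An infinite set with at most one element between any two consecutive cut points. -/
def Spread (cut : ℕ → ℕ) (H : Set ℕ) : Prop :=
  H.Infinite ∧ ∀ s, ∀ x ∈ H, ∀ y ∈ H, cut s ≤ x → x < y → cut (s + 1) ≤ y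

/-- The main diagonalization step. -/
theorem exists_forcing {cut : ℕ → ℕ}
    (hcut : ∀ (l : List Step) (m : ℕ) (r : Task m),
      (∀ n, ∃ N, ∀ p, r.Hits (reservoir l) n N p) →
        ∃ s, ∀ p, r.Hits (reservoir l) (cut s) (cut (s + 1)) p)
    {m : ℕ} (B : Fin m → Set ℕ) {l : List Step} (hl : (reservoir l).Infinite)
    (hB : ∀ x ∈ reservoir l, ∃ i, x ∈ B i) (F : Fin m → Finset ℕ) (a : Fin m → OracleCode) :
    ∃ (l' : List Step) (F' : Fin m → Finset ℕ), (reservoir l').Infinite ∧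
      reservoir l' ⊆ reservoir l ∧ (∀ i, F i ⊆ F' i) ∧
      (∀ i, ∀ z ∈ F' i, z ∈ F i ∨ z ∈ reservoir l ∧ z ∈ B i) ∧
      ∃ i, ∀ G : Set ℕ, ↑(F' i) ⊆ G → G ⊆ ↑(F' i) ∪ reservoir l' →
        ¬ Spread cut ((a i).accepts G) := by
  classical
  let r : Task m := fun i => (F i, a i)
  by_cases h : ∃ p, ∃ n, ∀ N, ¬ r.Hits (reservoir l) n N p
  · obtain ⟨l', i, hinf, hsub, n, hn⟩ := exists_reservoir_not_hits r hl h
    refine ⟨l', F, hinf, hsub, fun _ => subset_rfl, fun _ _ => .inl, i,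
      fun G hFG hGF hG => ?_⟩
    obtain ⟨x, hx, hnx⟩ := hG.1.exists_gt n
    obtain ⟨y, hy, hxy⟩ := hG.1.exists_gt x
    obtain ⟨u, hux, huy⟩ := (((a i).eventually_mem_accepts hx).and
      ((a i).eventually_mem_accepts hy)).exists
    -- By the use principle, this finite part of `G` together with the stem already accepts `x` and
    -- `y`.
    let E : Finset ℕ := (Finset.range u).filter fun z => z ∈ G ∧ z ∉ F i
    have hE : ∀ z < u, z ∈ (↑(F i) ∪ ↑E : Set ℕ) ↔ z ∈ G := fun z hz => by
      by_cases hzF : z ∈ F i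
      · simp [hzF, hFG hzF]
      · simp [E, hz, hzF]
    refine (hn E (fun z hz => ?_) x (hux _ hE) y (huy _ hE) hnx.le).not_gt hxy
    have hz' : z < u ∧ z ∈ G ∧ z ∉ F i := by simpa [E] using hz
    exact (hGF hz'.2.1).resolve_left hz'.2.2
  · push Not at h
    have htotal : ∀ n, ∃ N, ∀ p, r.Hits (reservoir l) n N p := fun n => by
      by_contra! hn
      obtain ⟨p, hp⟩ := r.exists_forall_not_hits _ n hn
      obtain ⟨N, hN⟩ := h p n
      exact hp N hN
    obtain ⟨s, hs⟩ := hcut l m r htotal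
    obtain ⟨x₀, hx₀⟩ := hl.nonempty
    have : Nonempty (Fin m) := ⟨(hB x₀ hx₀).choose⟩
    -- Hits exist for all partitions uniformly, hence for one compatible with `B`, to which `cut`
    -- makes no reference.
    choose! p hp using hB
    obtain ⟨i, E, hE, x, hx, y, hy, hsx, hxy, hys⟩ := hs p
    obtain ⟨u, hux, huy⟩ := (((a i).eventually_mem_accepts hx).and
      ((a i).eventually_mem_accepts hy)).exists
    -- Discarding the reservoir below the use `u` preserves both computations in all later
    -- extensions.
    refine ⟨.inl u :: l, Function.update F i (F i ∪ E), reservoir_inl_infinite hl u,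
      Set.inter_subset_left, fun j => ?_, fun j z hz => ?_, i, fun G hFG hGF hG => ?_⟩
    · obtain rfl | hj := eq_or_ne j i
      · simp
      · simp [hj]
    · obtain rfl | hj := eq_or_ne j i
      · rw [Function.update_self, Finset.mem_union] at hz
        exact hz.imp_right fun hz => ⟨(hE z hz).1, (hE z hz).2 ▸ hp z (hE z hz).1⟩
      · rw [Function.update_of_ne hj] at hz
        exact .inl hz
    · rw [Function.update_self, Finset.coe_union] at hFG hGF
      have hagree : ∀ z < u, z ∈ G ↔ z ∈ (↑(F i) ∪ ↑E : Set ℕ) := fun z hz =>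
        ⟨fun hzG => (hGF hzG).resolve_right fun hzl => hz.not_ge hzl.2, fun hzF => hFG hzF⟩
      exact (hG.2 s x (hux G hagree) y (huy G hagree) hsx hxy).not_gt hys

/-! ### Generic subsets of the parts -/

/-- Mathias conditions for building subsets of the sets `B i` simultaneously. -/
structure Condition {m : ℕ} (B : Fin m → Set ℕ) (l₀ : List Step) where
  stem : Fin m → Finset ℕ
  index : List Step
  stem_subset : ∀ i, ∀ z ∈ stem i, z ∈ B i
  infinite : (reservoir index).Infinite
  subset : reservoir index ⊆ reservoir l₀

namespace Condition

variable {m : ℕ} {B : Fin m → Set ℕ} {l₀ : List Step}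

/-- Larger conditions are stronger, so generic sequences increase. -/
instance : Preorder (Condition B l₀) where
  le p q := (∀ i, p.stem i ⊆ q.stem i) ∧
    (∀ i, ∀ z ∈ q.stem i, z ∈ p.stem i ∨ z ∈ reservoir p.index) ∧
    reservoir q.index ⊆ reservoir p.index
  le_refl p := ⟨fun _ => subset_rfl, fun _ _ => .inl, subset_rfl⟩
  le_trans p q r hpq hqr := ⟨fun i => (hpq.1 i).trans (hqr.1 i), fun i z hz =>
    (hqr.2.1 i z hz).elim (hpq.2.1 i z) fun h => .inr (hpq.2.2 h), hqr.2.2.trans hpq.2.2⟩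

/-- It suffices to defeat one index for every tuple of functionals: if each generic set computed a
spread set, the functionals doing so would form a tuple with no defeated index. The hypothesis
`hmeet` lets all stems grow without bound. -/
theorem exists_generic {cut : ℕ → ℕ}
    (hcut : ∀ (l : List Step) (m : ℕ) (r : Task m),
      (∀ n, ∃ N, ∀ p, r.Hits (reservoir l) n N p) →
        ∃ s, ∀ p, r.Hits (reservoir l) (cut s) (cut (s + 1)) p)
    (hl₀ : (reservoir l₀).Infinite) (hB : ∀ x ∈ reservoir l₀, ∃ i, x ∈ B i)
    (hmeet : ∀ l, (reservoir l).Infinite → reservoir l ⊆ reservoir l₀ →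
      ∀ i, (reservoir l ∩ B i).Infinite) :
    ∃ i, ∃ G ⊆ B i, G.Infinite ∧ ∀ a : OracleCode, ¬ Spread cut (a.accepts G) := by
  classical
  let 𝒟 : (Fin m → OracleCode) ⊕ ℕ → Order.Cofinal (Condition B l₀) := fun
    | .inl a =>
      { carrier := {p | ∃ i, ∀ G : Set ℕ, ↑(p.stem i) ⊆ G →
          G ⊆ ↑(p.stem i) ∪ reservoir p.index → ¬ Spread cut ((a i).accepts G)}
        isCofinal := fun p => by
          obtain ⟨l', F', hinf, hsub, hF, hF', hforce⟩ := exists_forcing hcut B p.infinite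
            (fun x hx => hB x (p.subset hx)) p.stem a
          exact ⟨⟨F', l', fun i z hz => (hF' i z hz).elim (p.stem_subset i z) And.right,
            hinf, hsub.trans p.subset⟩, hforce,
            hF, fun i z hz => (hF' i z hz).imp_right And.left, hsub⟩ }
    | .inr n =>
      { carrier := {p | ∀ i, ∃ z ∈ p.stem i, n < z}
        isCofinal := fun p => by
          choose z hz hnz using fun i => (hmeet p.index p.infinite p.subset i).exists_gt n
          refine ⟨⟨fun i => insert (z i) (p.stem i), p.index, fun i x hx => ?_,
            p.infinite, p.subset⟩, fun i => ⟨z i, Finset.mem_insert_self _ _, hnz i⟩,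
            fun i => Finset.subset_insert _ _, fun i x hx => ?_, subset_rfl⟩
          · obtain rfl | hx := Finset.mem_insert.1 hx
            exacts [(hz i).2, p.stem_subset i x hx]
          · obtain rfl | hx := Finset.mem_insert.1 hx
            exacts [.inr (hz i).1, .inl hx] }
  have : Encodable ((Fin m → OracleCode) ⊕ ℕ) := Encodable.ofCountable _
  let p₀ : Condition B l₀ := ⟨fun _ => ∅, l₀, by simp, hl₀, subset_rfl⟩
  let q := Order.sequenceOfCofinals p₀ 𝒟
  have hq : Monotone q := Order.sequenceOfCofinals.monotone p₀ 𝒟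
  have hmem : ∀ d, ∃ n, q n ∈ 𝒟 d := fun d =>
    ⟨_, Order.sequenceOfCofinals.encode_mem p₀ 𝒟 d⟩
  let G : Fin m → Set ℕ := fun i => ⋃ n, ↑((q n).stem i)
  have hG : ∀ n i, G i ⊆ ↑((q n).stem i) ∪ reservoir (q n).index := fun n i z hz => by
    obtain ⟨k, hk⟩ := Set.mem_iUnion.1 hz
    obtain hnk | hkn := le_total n k
    · exact (hq hnk).2.1 i z hk
    · exact .inl ((hq hkn).1 i hk)
  have key : ∃ i, ∀ a : OracleCode, ¬ Spread cut (a.accepts (G i)) := by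
    by_contra! hcon
    choose a ha using hcon
    obtain ⟨n, i, hi⟩ := hmem (.inl a)
    exact hi (G i) (Set.subset_iUnion (fun n => (↑((q n).stem i) : Set ℕ)) n) (hG n i) (ha i)
  obtain ⟨i, hi⟩ := key
  refine ⟨i, G i, Set.iUnion_subset fun n => (q n).stem_subset i,
    Set.infinite_of_forall_exists_gt fun k => ?_, hi⟩
  obtain ⟨n, hn⟩ := hmem (.inr k)
  obtain ⟨z, hz, hkz⟩ := hn i
  exact ⟨z, Set.mem_iUnion.2 ⟨n, hz⟩, hkz⟩

end Condition

/-- Induction on the number of parts: a part meeting some infinite reservoir only finitely is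
dropped, and the reservoir is cut above the intersection. If there is no such part, the generic
construction applies. -/
theorem exists_subset_not_spread {cut : ℕ → ℕ}
    (hcut : ∀ (l : List Step) (m : ℕ) (r : Task m),
      (∀ n, ∃ N, ∀ p, r.Hits (reservoir l) n N p) →
        ∃ s, ∀ p, r.Hits (reservoir l) (cut s) (cut (s + 1)) p)
    {m : ℕ} (B : Fin m → Set ℕ) {l : List Step} (hl : (reservoir l).Infinite)
    (hB : ∀ x ∈ reservoir l, ∃ i, x ∈ B i) :
    ∃ i, ∃ G ⊆ B i, G.Infinite ∧ ∀ a : OracleCode, ¬ Spread cut (a.accepts G) := by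
  induction m generalizing l with
  | zero => exact (hB _ hl.nonempty.choose_spec).choose.elim0
  | succ m ih =>
    by_cases h : ∀ l', (reservoir l').Infinite → reservoir l' ⊆ reservoir l →
      ∀ i, (reservoir l' ∩ B i).Infinite
    · exact Condition.exists_generic hcut hl hB h
    · push Not at h
      obtain ⟨l', hl', hsub, i, hfin⟩ := h
      obtain ⟨u, hu⟩ := hfin.bddAbove
      obtain ⟨j, hj⟩ := ih (B ∘ i.succAbove) (reservoir_inl_infinite hl' (u + 1))
        fun x hx => by
          obtain ⟨j, hj⟩ := hB x (hsub hx.1)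
          obtain rfl | ⟨k, rfl⟩ := i.eq_self_or_eq_succAbove j
          · exact absurd (hu ⟨hx.1, hj⟩) (Nat.not_le.2 hx.2)
          · exact ⟨k, hj⟩
      exact ⟨_, hj⟩

/-! ### The coloring and the conclusion -/

/-- The coloring that gives two numbers the color `1` if no cut point separates them. -/
noncomputable def cutColoring (cut : ℕ → ℕ) : Coloring 2 := by
  classical
  exact fun x y => if ∃ s, cut s ≤ x ∧ y < cut (s + 1) then 1 else 0

variable {cut : ℕ → ℕ}

theorem cutColoring_eq_zero (hcut : StrictMono cut) (x : ℕ) :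
    ∃ z, ∀ y, z ≤ y → cutColoring cut x y = 0 := by
  -- A block starting at or below `x` has index at most `x`, since `s ≤ cut s`, and so ends by `cut
  -- (x + 1)`.
  refine ⟨cut (x + 1), fun y hy => if_neg ?_⟩
  rintro ⟨s, hsx, hys⟩
  have hs : s ≤ x := (hcut.id_le s).trans hsx
  exact (hys.trans_le (hcut.monotone (Nat.succ_le_succ hs))).not_ge hy

theorem cutColoring_stable (hcut : StrictMono cut) : (cutColoring cut).Stable := fun x =>
  have ⟨z, hz⟩ := cutColoring_eq_zero hcut x
  ⟨0, z, fun y hy _ => hz y hy⟩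

/-- Since all limits are 0, an infinite homogeneous set must have color 0. -/
theorem spread_of_homogeneous (hcut : StrictMono cut) {H : Set ℕ} (hH : H.Infinite)
    (h : (cutColoring cut).Homogeneous H) : Spread cut H := by
  obtain ⟨j, hj⟩ := h
  obtain ⟨x₀, hx₀⟩ := hH.nonempty
  obtain ⟨z, hz⟩ := cutColoring_eq_zero hcut x₀
  obtain ⟨y₀, hy₀, hlt⟩ := hH.exists_gt (max x₀ z)
  have hj0 : j = 0 := by
    rw [← hj x₀ hx₀ y₀ hy₀ ((le_max_left _ _).trans_lt hlt),
      hz y₀ ((le_max_right _ _).trans hlt.le)]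
  refine ⟨hH, fun s x hx y hy hsx hxy => ?_⟩
  by_contra! hys
  have h1 : cutColoring cut x y = 1 := if_pos ⟨s, hsx, hys⟩
  rw [hj x hx y hy hxy, hj0] at h1
  exact absurd h1 (by decide)

/-- A solution may be witnessed by a different coloring with the same graph; this makes the
difference harmless. -/
theorem Coloring.eq_of_graph_eq {k : ℕ} {c d : Coloring k} (h : c.graph = d.graph) {x y : ℕ}
    (hxy : x < y) : c x y = d x y := by
  have hmem : Nat.pair (Nat.pair x y) (c x y) ∈ d.graph := h ▸ ⟨x, y, hxy, rfl⟩
  obtain ⟨x', y', -, h'⟩ := hmem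
  obtain ⟨h₁, h₂⟩ := Nat.pair_eq_pair.1 h'
  obtain ⟨rfl, rfl⟩ := Nat.pair_eq_pair.1 h₁
  exact Fin.ext h₂

/-- There is an instance of `SRT²₂` such that every finite partition of `ℕ` has a part with an
infinite subset that computes no solution to it. -/
theorem exists_instance_avoiding_partitions : ∃ X, (SRT2 2).IsInstance X ∧
    ∀ (k : ℕ) (B : Fin k → Set ℕ), (∀ x, ∃ i, x ∈ B i) → ∃ i, ∃ G ⊆ B i, G.Infinite ∧
      ∀ Y, (SRT2 2).IsSolution X Y → ¬ Computes G Y := by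
  obtain ⟨cut, hmono, hcut⟩ := exists_cut
  refine ⟨_, ⟨cutColoring cut, cutColoring_stable hmono, rfl⟩, fun k B hB => ?_⟩
  obtain ⟨i, G, hGB, hG, hspread⟩ := exists_subset_not_spread hcut B (l := [])
    Set.infinite_univ fun x _ => hB x
  refine ⟨i, G, hGB, hG, ?_⟩
  rintro Y ⟨c, -, hc, hY, j, hj⟩ hcomp
  obtain ⟨a, rfl⟩ := hcomp.exists_accepts_eq
  exact hspread a (spread_of_homogeneous hmono hY ⟨j, fun x hx y hy hxy =>
    (Coloring.eq_of_graph_eq hc hxy).trans (hj x hx y hy hxy)⟩)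

/-- `SRT²₂` is not reducible to a principle each instance of which has all infinite subsets of
the parts of some finite partition of `ℕ` as solutions. -/
theorem not_stronglyComputablyReducible_of_partition (P : Principle)
    (hP : ∀ X, P.IsInstance X → ∃ (k : ℕ) (B : Fin k → Set ℕ), (∀ x, ∃ i, x ∈ B i) ∧
      ∀ i, ∀ G ⊆ B i, G.Infinite → P.IsSolution X G) :
    ¬ StronglyComputablyReducible (SRT2 2) P := by
  intro h
  obtain ⟨X, hX, hpart⟩ := exists_instance_avoiding_partitions
  obtain ⟨X', hX', -, hsol⟩ := h X hX
  obtain ⟨k, B, hB, hBsol⟩ := hP X' hX'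
  obtain ⟨i, G, hGB, hG, hnot⟩ := hpart k B hB
  obtain ⟨Y, hY, hcomp⟩ := hsol G (hBsol i G hGB hG)
  exact hnot Y hY hcomp

/-- The parts are the limit-color classes, which cover everything by stability. -/
theorem D2_partition (k : ℕ) (X : Set ℕ) (hX : (D2 k).IsInstance X) :
    ∃ B : Fin k → Set ℕ, (∀ x, ∃ i, x ∈ B i) ∧
      ∀ i, ∀ G ⊆ B i, G.Infinite → (D2 k).IsSolution X G := by
  obtain ⟨d, hd, rfl⟩ := hX
  exact ⟨fun j => {x | d.HasLimit x j}, hd, fun j G hGB hG => ⟨d, hd, rfl, hG, j, hGB⟩⟩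

end StrongReductions

theorem mainTheorem11 :
    ¬ StrongReductions.StronglyComputablyReducible
        (StrongReductions.SRT2 2) StrongReductions.D2LtInfty ∧
      ¬ StrongReductions.StronglyComputablyReducible
        (StrongReductions.SRT2 2) (StrongReductions.D2 2) := by
  refine ⟨StrongReductions.not_stronglyComputablyReducible_of_partition _ ?_,
    StrongReductions.not_stronglyComputablyReducible_of_partition _ fun X hX =>
      ⟨2, StrongReductions.D2_partition 2 X hX⟩⟩
  rintro _ ⟨k, X, hk, hX, rfl⟩
  obtain ⟨B, hB, hsol⟩ := StrongReductions.D2_partition k X hX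
  exact ⟨k, B, hB, fun i G hGB hG => ⟨k, X, hk, hX, rfl, hsol i G hGB hG⟩⟩
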